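/- **Notation.** A Young function is a convex, continuous, non-constant function $A:[0,\infty)\to[0,\infty]$ with $A(0)=0$; its left-continuous inverse is $A^{-1}(t)=\inf\{\tau\ge 0: A(\tau)\ge t\}$. A generalized Young function is a function $\varphi:\mathbb R^n\times[0,\infty)\to[0,\infty]$ such that $\varphi(x,\cdot)$ is a Young function for a.e. $x$ and $\varphi(\cdot,t)$ is (Lebesgue) measurable for every $t\ge0$; $\varphi^{-1}(x,\cdot)$ denotes the left-continuous inverse of $\varphi(x,\cdot)$. It satisfies - (A0) if there is $\beta\in(0,1]$ with $\beta\le\varphi^{-1}(x,1)\le\frac1\beta$ for a.e. $x\in\mathbb R^n$; - (A1) if there is $\beta\in(0,1]$ with $\beta\varphi^{-1}(x,t)\le\varphi^{-1}(y,t)$ for every ball $B$ with $|B|\le1$, a.e. $x,y\in B$ and every $t\in[1,\frac1{|B|}]$; - (A2) if for every $s>0$ there are $\beta\in(0,1]$ and $h\in L^1(\mathbb R^n)\cap L^\infty(\mathbb R^n)$ with $\beta\varphi^{-1}(x,t)\le\varphi^{-1}(y,t)$ for a.e. $x,y\in\mathbb R^n$ and every $t\ge0$ with $h(x)+h(y)\le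 t\le s$. Set $\varphi_\infty(t)=\limsup_{|x|\to\infty}\varphi(x,t)$ for $t\ge0$, where upper limits as $|x|\to\infty$ are essential ones (null sets of $x$ are disregarded). Let $$\varphi_0(x,t)=\max\{\varphi(x,\varphi^{-1}(x,1)\,t),\,2t-1\},\qquad \overline\varphi(x,t)=\begin{cases}2\varphi_0(x,t)-1 & \text{if } t\ge1,\\ \limsup_{|x|\to\infty}\varphi_0(x,t) & \text{if } 0\le t<1.\end{cases}$$ For a measurable function $f$ on $\mathbb R^n$ let $\|f\|_{L^{\varphi(\cdot)}(\mathbb R^n)}=\inf\{\lambda>0:\int_{\mathbb R^n}\varphi(x,|f(x)|/\lambda)\,dx\le1\}$ and, for $\alpha\in(0,n)$, let $I_\alpha f(x)=\int_{\mathbb R^n}\frac{f(y)}{|x-y|^{n-\alpha}}\,dy\in[-\infty,\infty]$ at every $x$ where this integral exists. The set $\{|I_\alpha f|>t\}$ consists of the points $x$ at which the integral exists and $|I_\alpha f(x)|>t$. **Proposition 4.3.** Let $n\ge1$, $\alpha\in(0,n)$, and let $\varphi$ be a generalized Young function satisfying (A0), (A1) and (A2). Assume that there exist a generalized Young function $\vartheta$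 and a constant $c>0$ such that $$\int_{\{|I_\alpha f|>t\}}\vartheta(x,ct)\,dx\le\int_{\mathbb R^n}\overline\varphi(x,|f(x)|)\,dx\qquad\text{for every } t\ge0$$ for every measurable $f:\mathbb R^n\to\mathbb R$ with $\|f\|_{L^{\varphi(\cdot)}(\mathbb R^n)}\le1$. Then $$\int_0\Big(\frac t{\varphi_\infty(t)}\Big)^{\frac\alpha{n-\alpha}}\,dt<\infty,$$ that is, for some $\delta>0$ the integral over $(0,\delta)$ is finite (the integrand being $\infty$ where $\varphi_\infty(t)=0$ and $0$ where $\varphi_\infty(t)=\infty$). -/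

import Mathlib

open MeasureTheory Filter
open scoped NNReal ENNReal

noncomputable section

namespace MusielakOrlicz

/-- A Young function `A : [0, ∞) → [0, ∞]`: convex, continuous (as a map into the extended
half-line), non-constant, and vanishing at `0`. -/
structure IsYoung (A : ℝ≥0 → ℝ≥0∞) : Prop where
  convex : ConvexOn ℝ≥0 Set.univ A
  continuous : Continuous A
  nonconstant : ∃ s t, A s ≠ A t
  map_zero : A 0 = 0

/-- The left-continuous inverse `A⁻¹(t) = inf {τ ≥ 0 : A(τ) ≥ t}`, for `0 ≤ t < ∞`. -/
def leftInv (A : ℝ≥0 → ℝ≥0∞) (t : ℝ≥0) : ℝ≥0 :=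
  sInf {τ : ℝ≥0 | (t : ℝ≥0∞) ≤ A τ}

variable {n : ℕ}

/-- A generalized Young function on `ℝⁿ × [0, ∞)`: a Young function of the second variable for
almost every `x`, and a Lebesgue measurable function of `x` for every `t`.
(`AEMeasurable` with respect to Lebesgue measure is Lebesgue measurability.) -/
structure IsGeneralizedYoung (φ : EuclideanSpace ℝ (Fin n) → ℝ≥0 → ℝ≥0∞) : Prop where
  young : ∀ᵐ x, IsYoung (φ x)
  measurable : ∀ t, AEMeasurable (fun x => φ x t) volume

/-- Condition (A0). -/
def CondA0 (φ : EuclideanSpace ℝ (Fin n) → ℝ≥0 → ℝ≥0∞) : Prop :=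
  ∃ β : ℝ≥0, 0 < β ∧ β ≤ 1 ∧ ∀ᵐ x, β ≤ leftInv (φ x) 1 ∧ leftInv (φ x) 1 ≤ 1 / β

/-- Condition (A1). -/
def CondA1 (φ : EuclideanSpace ℝ (Fin n) → ℝ≥0 → ℝ≥0∞) : Prop :=
  ∃ β : ℝ≥0, 0 < β ∧ β ≤ 1 ∧
    ∀ (z : EuclideanSpace ℝ (Fin n)) (r : ℝ), 0 < r → volume (Metric.ball z r) ≤ 1 →
      ∀ᵐ x, x ∈ Metric.ball z r → ∀ᵐ y, y ∈ Metric.ball z r →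
        ∀ t : ℝ≥0, 1 ≤ t → (t : ℝ≥0∞) ≤ (volume (Metric.ball z r))⁻¹ →
          β * leftInv (φ x) t ≤ leftInv (φ y) t

/-- Condition (A2). -/
def CondA2 (φ : EuclideanSpace ℝ (Fin n) → ℝ≥0 → ℝ≥0∞) : Prop :=
  ∀ s : ℝ≥0, 0 < s →
    ∃ β : ℝ≥0, 0 < β ∧ β ≤ 1 ∧ ∃ h : EuclideanSpace ℝ (Fin n) → ℝ,
      MemLp h 1 volume ∧ MemLp h ∞ volume ∧
        ∀ᵐ x, ∀ᵐ y, ∀ t : ℝ≥0, h x + h y ≤ (t : ℝ) → t ≤ s →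
          β * leftInv (φ x) t ≤ leftInv (φ y) t

/-- `φ_∞(t) = limsup_{|x| → ∞} φ(x, t)`. As generalized Young functions are only constrained
for almost every `x`, the upper limit disregards null sets of `x`. -/
def atInfinity (φ : EuclideanSpace ℝ (Fin n) → ℝ≥0 → ℝ≥0∞) (t : ℝ≥0) : ℝ≥0∞ :=
  limsup (fun x => φ x t) (Bornology.cobounded (EuclideanSpace ℝ (Fin n)) ⊓ ae volume)

/-- `φ₀(x, t) = max {φ(x, φ⁻¹(x, 1) t), 2 t - 1}`. The subtraction is truncated at `0`, which
does not affect the maximum since `φ ≥ 0`. -/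
def phi0 (φ : EuclideanSpace ℝ (Fin n) → ℝ≥0 → ℝ≥0∞)
    (x : EuclideanSpace ℝ (Fin n)) (t : ℝ≥0) : ℝ≥0∞ :=
  max (φ x (leftInv (φ x) 1 * t)) (2 * (t : ℝ≥0∞) - 1)

open Classical in
/-- The function `φ̄`, equal to `2 φ₀(x, t) - 1` if `t ≥ 1` (where `φ₀ ≥ 1`), and to
`limsup_{|x| → ∞} φ₀(x, t)` if `0 ≤ t < 1`. -/
def phiBar (φ : EuclideanSpace ℝ (Fin n) → ℝ≥0 → ℝ≥0∞)
    (x : EuclideanSpace ℝ (Fin n)) (t : ℝ≥0) : ℝ≥0∞ :=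
  if 1 ≤ t then 2 * phi0 φ x t - 1 else atInfinity (phi0 φ) t

/-- The modular `∫ φ(x, |f(x)|) dx`. -/
def modular (φ : EuclideanSpace ℝ (Fin n) → ℝ≥0 → ℝ≥0∞)
    (f : EuclideanSpace ℝ (Fin n) → ℝ) : ℝ≥0∞ :=
  ∫⁻ x, φ x ‖f x‖₊

/-- The Luxemburg norm of `L^φ(ℝⁿ)`: the infimum of all `l > 0` such that
`∫ φ(x, |f(x)| / l) dx ≤ 1`, which is `∞` if there is no such `l`. -/
def luxNorm (φ : EuclideanSpace ℝ (Fin n) → ℝ≥0 → ℝ≥0∞)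
    (f : EuclideanSpace ℝ (Fin n) → ℝ) : ℝ≥0∞ :=
  ⨅ (l : ℝ≥0) (_ : 0 < l) (_ : ∫⁻ x, φ x (‖f x‖₊ / l) ≤ 1), (l : ℝ≥0∞)

/-- `∫ f(y)⁺ / |x - y|^(n - α) dy`. -/
def rieszPos (α : ℝ) (f : EuclideanSpace ℝ (Fin n) → ℝ)
    (x : EuclideanSpace ℝ (Fin n)) : ℝ≥0∞ :=
  ∫⁻ y, ENNReal.ofReal (f y / ‖x - y‖ ^ ((n : ℝ) - α))

open Classical in
/-- The Riesz potential `I_α f(x) = ∫ f(y) / |x - y|^(n - α) dy`, with values in `[-∞, ∞]`: the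
integral of the positive part minus that of the negative part. At the points where both are
infinite the integral does not exist; it is given the value `0` there, so that a bound on
`{|I_α f| > t}` asks nothing at such points. -/
def rieszPotential (α : ℝ) (f : EuclideanSpace ℝ (Fin n) → ℝ)
    (x : EuclideanSpace ℝ (Fin n)) : EReal :=
  if rieszPos α f x = ∞ ∧ rieszPos α (fun y => -f y) x = ∞ then 0
  else (rieszPos α f x : EReal) - (rieszPos α (fun y => -f y) x : EReal)

end MusielakOrlicz

end

/-! Argue by contradiction, with `A = φ_∞`, `w(y) = |y|^(α-n)` and the integral over `(0, 1]`
divergent. A bounded `f ≥ 0` supported off the unit ball is built with `∫ A(f) < ∞` and `∫ w f = ∞`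
(`exists_infinite_pairing`). The near-optimal choice is `f = H(λ w)`, where `H(u)` is the largest
`t` with `A t ≤ u t`: its modular is controlled by `λ ∫ w f`, while the layer-cake formula turns `∫
w f` into the given integral, because `{λ w ≥ A t / t}` is a ball with `w`-mass comparable to `(λ t
/ A t)^(α/(n-α))`.

By (A0) and (A2), `φ(x, κ t) ≤ φ_∞(t) + h(x)` with `∫ h < ∞` (`exists_le_atInfinity_add`), so a
small multiple `F` of `f` lies in the unit ball of `L^φ`. Its `φ̄`-modular is finite, yet `I_α F =
∞` everywhere. The weak inequality then bounds `∫ ϑ(x, c t) dx` uniformly in `t`, which Fatou's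
lemma forbids (`not_forall_lintegral_le`). -/

namespace MusielakOrlicz

/-! ### Star-shaped functions and the inverse of their slope -/

/-- The graph of `A` is star-shaped with respect to the origin: `A (θ t) ≤ θ A t` for `θ ≤ 1`. -/
def IsStarShaped (A : ℝ≥0 → ℝ≥0∞) : Prop :=
  ∀ θ t : ℝ≥0, θ ≤ 1 → A (θ * t) ≤ θ * A t

theorem IsStarShaped.map_zero {A : ℝ≥0 → ℝ≥0∞} (hA : IsStarShaped A) : A 0 = 0 := by
  simpa using hA 0 0 zero_le_one

theorem IsStarShaped.monotone {A : ℝ≥0 → ℝ≥0∞} (hA : IsStarShaped A) : Monotone A := by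
  intro s t hst
  rcases eq_or_ne t 0 with rfl | ht
  · simp [le_antisymm hst zero_le]
  · have h1 : s / t ≤ 1 := div_le_one_of_le₀ hst zero_le
    have h := hA (s / t) t h1
    rw [div_mul_cancel₀ _ ht] at h
    exact h.trans (mul_le_of_le_one_left zero_le (by exact_mod_cast h1))

theorem IsYoung.isStarShaped {A : ℝ≥0 → ℝ≥0∞} (hA : IsYoung A) : IsStarShaped A := by
  intro θ t hθ
  have h := hA.convex.2 (Set.mem_univ t) (Set.mem_univ 0) zero_le zero_le
    (add_tsub_cancel_of_le hθ)
  simpa [hA.map_zero, ENNReal.smul_def] using h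

/-- The largest `t ≤ δ` with `A t / t ≤ u`. -/
noncomputable def slopeInv (A : ℝ≥0 → ℝ≥0∞) (δ : ℝ≥0) (u : ℝ≥0∞) : ℝ≥0 :=
  sSup {t : ℝ≥0 | t ≤ δ ∧ A t ≤ u * t}

section slopeInv

variable {A : ℝ≥0 → ℝ≥0∞} {δ : ℝ≥0}

theorem bddAbove_slopeInv (A : ℝ≥0 → ℝ≥0∞) (δ : ℝ≥0) (u : ℝ≥0∞) :
    BddAbove {t : ℝ≥0 | t ≤ δ ∧ A t ≤ u * t} := ⟨δ, fun _ h => h.1⟩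

theorem IsStarShaped.zero_mem (hA : IsStarShaped A) (u : ℝ≥0∞) :
    (0 : ℝ≥0) ∈ {t : ℝ≥0 | t ≤ δ ∧ A t ≤ u * t} := by
  simp [hA.map_zero]

theorem le_slopeInv {u : ℝ≥0∞} {t : ℝ≥0} (ht : t ≤ δ) (h : A t ≤ u * t) :
    t ≤ slopeInv A δ u := le_csSup (bddAbove_slopeInv A δ u) ⟨ht, h⟩

theorem slopeInv_le (hA : IsStarShaped A) (u : ℝ≥0∞) : slopeInv A δ u ≤ δ :=
  csSup_le ⟨0, hA.zero_mem u⟩ fun _ h => h.1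

theorem slopeInv_mono (hA : IsStarShaped A) : Monotone (slopeInv A δ) := fun u v huv =>
  csSup_le_csSup (bddAbove_slopeInv A δ v) ⟨0, hA.zero_mem u⟩ fun t ht =>
    ⟨ht.1, ht.2.trans (by gcongr)⟩

/-- The supremum need not be attained, since `A` may jump. Half of it lies below an admissible `t`,
and star-shapedness carries the slope bound down from `t`. -/
theorem apply_half_slopeInv_le (hA : IsStarShaped A) (u : ℝ≥0∞) :
    A (slopeInv A δ u / 2) ≤ u * slopeInv A δ u := by
  rcases eq_or_ne (slopeInv A δ u) 0 with h0 | h0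
  · simp [h0, hA.map_zero]
  · have hlt : slopeInv A δ u / 2 < slopeInv A δ u := NNReal.half_lt_self h0
    obtain ⟨t, ht, hlt'⟩ := exists_lt_of_lt_csSup ⟨0, hA.zero_mem u⟩ hlt
    set H := slopeInv A δ u
    have ht0 : t ≠ 0 := (lt_of_le_of_lt zero_le hlt').ne'
    have h := hA (H / 2 / t) t (div_le_one_of_le₀ hlt'.le zero_le)
    rw [div_mul_cancel₀ _ ht0] at h
    calc A (H / 2) ≤ ((H / 2 / t : ℝ≥0) : ℝ≥0∞) * A t := h
      _ ≤ ((H / 2 / t : ℝ≥0) : ℝ≥0∞) * (u * t) := by gcongr; exact ht.2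
      _ = u * ((H / 2 / t * t : ℝ≥0) : ℝ≥0∞) := by push_cast; ring
      _ ≤ u * H := by rw [div_mul_cancel₀ _ ht0]; gcongr

end slopeInv

variable {n : ℕ}

local notation "E" => EuclideanSpace ℝ (Fin n)

/-! ### Mass of the Riesz kernel -/

/-- `|y|^(α - n)`, the Riesz kernel. -/
noncomputable def rieszKernel (α : ℝ) (y : EuclideanSpace ℝ (Fin n)) : ℝ≥0∞ :=
  ENNReal.ofReal (‖y‖ ^ (α - n))

theorem measurable_rieszKernel (α : ℝ) : Measurable (rieszKernel (n := n) α) := by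
  unfold rieszKernel; fun_prop

theorem rieszKernel_anti {α : ℝ} (hαn : α < n) {y : E} {r : ℝ} (hy : 0 < ‖y‖) (h : ‖y‖ ≤ r) :
    ENNReal.ofReal (r ^ (α - n)) ≤ rieszKernel α y :=
  ENNReal.ofReal_le_ofReal (Real.rpow_le_rpow_of_nonpos hy h (by linarith))

theorem rieszKernel_le {α : ℝ} (hαn : α < n) {y : E} {r : ℝ} (hr : 0 < r) (h : r ≤ ‖y‖) :
    rieszKernel α y ≤ ENNReal.ofReal (r ^ (α - n)) :=
  ENNReal.ofReal_le_ofReal (Real.rpow_le_rpow_of_nonpos hr h (by linarith))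

theorem volume_closedBall_eq (r : ℝ) (hr : 0 ≤ r) :
    volume (Metric.closedBall (0 : E) r) =
      ENNReal.ofReal (r ^ n) * volume (Metric.ball (0 : E) 1) := by
  simpa using Measure.addHaar_closedBall (volume : Measure E) (0 : E) hr

/-- The Riesz kernel has mass at least `ω (ρ ^ α - R ^ α)` on an annulus. -/
theorem mul_rpow_le_lintegral_annulus {α : ℝ} (hαn : α < n) {R ρ : ℝ} (hR : 0 < R)
    (hRρ : R ≤ ρ) :
    volume (Metric.ball (0 : E) 1) * ENNReal.ofReal (ρ ^ α) ≤
      (∫⁻ y in {y : E | R < ‖y‖ ∧ ‖y‖ ≤ ρ}, rieszKernel α y) +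
        volume (Metric.ball (0 : E) 1) * ENNReal.ofReal (R ^ α) := by
  have hρ : 0 < ρ := hR.trans_le hRρ
  set ω := volume (Metric.ball (0 : E) 1)
  set S : Set E := {y : E | R < ‖y‖ ∧ ‖y‖ ≤ ρ}
  have hS : MeasurableSet S :=
    (measurableSet_lt measurable_const measurable_norm).inter
      (measurableSet_le measurable_norm measurable_const)
  -- The kernel is at least its value at the outer radius; this crude bound already has the right
  -- order `ρ ^ α`.
  have h1 : ENNReal.ofReal (ρ ^ (α - n)) * volume S ≤ ∫⁻ y in S, rieszKernel α y := by
    rw [← setLIntegral_const]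
    exact setLIntegral_mono (measurable_rieszKernel α) fun y hy =>
      rieszKernel_anti hαn (hR.trans hy.1) hy.2
  have h2 : volume (Metric.closedBall (0 : E) ρ) ≤ volume S + volume (Metric.closedBall (0 : E) R) := by
    refine (measure_mono fun y hy => ?_).trans (measure_union_le _ _)
    simp only [Metric.mem_closedBall, dist_zero_right] at hy
    by_cases h : R < ‖y‖
    · exact Or.inl ⟨h, hy⟩
    · exact Or.inr (by simpa using not_lt.mp h)
  rw [volume_closedBall_eq ρ hρ.le, volume_closedBall_eq R hR.le] at h2
  have h3 : ρ ^ α = ρ ^ (α - n) * ρ ^ n := by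
    rw [← Real.rpow_natCast ρ n, ← Real.rpow_add hρ]; congr 1; ring
  have h4 : ρ ^ (α - n) * R ^ n ≤ R ^ α := by
    have : R ^ α = R ^ (α - n) * R ^ n := by
      rw [← Real.rpow_natCast R n, ← Real.rpow_add hR]; congr 1; ring
    rw [this]
    exact mul_le_mul_of_nonneg_right (Real.rpow_le_rpow_of_nonpos hR hRρ (by linarith))
      (by positivity)
  have hpos : 0 ≤ ρ ^ (α - n) := by positivity
  calc ω * ENNReal.ofReal (ρ ^ α)
      = ENNReal.ofReal (ρ ^ (α - n)) * (ENNReal.ofReal (ρ ^ n) * ω) := by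
        rw [h3, ENNReal.ofReal_mul hpos]; ring
    _ ≤ ENNReal.ofReal (ρ ^ (α - n)) * (volume S + ENNReal.ofReal (R ^ n) * ω) := by gcongr
    _ = ENNReal.ofReal (ρ ^ (α - n)) * volume S + ω * ENNReal.ofReal (ρ ^ (α - n) * R ^ n) := by
        rw [ENNReal.ofReal_mul hpos]; ring
    _ ≤ _ := by gcongr

/-- Lower bound for the mass that the Riesz kernel has on its own superlevel sets. -/
theorem mul_rpow_div_le_lintegral_superlevel {α : ℝ} (hα0 : 0 < α) (hαn : α < n) {R : ℝ}
    (hR : 0 < R) (lam t : ℝ≥0) (a : ℝ≥0∞) :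
    volume (Metric.ball (0 : E) 1) * (lam * (t / a)) ^ (α / ((n : ℝ) - α)) ≤
      (∫⁻ y in {y : E | R < ‖y‖ ∧ a ≤ lam * rieszKernel α y * t}, rieszKernel α y) +
        volume (Metric.ball (0 : E) 1) * ENNReal.ofReal (R ^ α) := by
  have hω0 : volume (Metric.ball (0 : E) 1) ≠ 0 := (Metric.measure_ball_pos _ _ one_pos).ne'
  have hωt : volume (Metric.ball (0 : E) 1) ≠ ∞ := measure_ball_lt_top.ne
  have hp : 0 < α / ((n : ℝ) - α) := div_pos hα0 (by linarith)
  rw [mul_comm, ← ENNReal.le_div_iff_mul_le (Or.inl hω0) (Or.inl hωt)]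
  -- The superlevel set is essentially a shell of outer radius `(lam t / a)^(1/(n-α))`, possibly
  -- infinite. It is exhausted by finite radii `ρ` with `ρ ^ α = r`.
  refine ENNReal.le_of_forall_nnreal_lt fun r hr => ?_
  rw [ENNReal.le_div_iff_mul_le (Or.inl hω0) (Or.inl hωt), mul_comm]
  set ρ : ℝ := (r : ℝ) ^ (1 / α) with hρdef
  have hrρ : ρ ^ α = r := by
    rw [hρdef, ← Real.rpow_mul (NNReal.coe_nonneg r), one_div_mul_cancel hα0.ne', Real.rpow_one]
  have hρ0 : 0 ≤ ρ := by positivity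
  have hr' : (r : ℝ≥0∞) = ENNReal.ofReal (ρ ^ α) := by rw [hrρ, ENNReal.ofReal_coe_nnreal]
  rcases le_total ρ R with h | h
  · rw [hr']
    refine le_add_left ?_
    gcongr
  · rw [hr']
    refine (mul_rpow_le_lintegral_annulus hαn hR h).trans ?_
    gcongr ?_ + _
    refine lintegral_mono_set fun y hy => ⟨hy.1, ?_⟩
    have hρ : 0 < ρ := hR.trans_le h
    have h5 : ENNReal.ofReal (ρ ^ ((n : ℝ) - α)) ≤ lam * (t / a) := by
      have h6 : ENNReal.ofReal (ρ ^ ((n : ℝ) - α)) ^ (α / ((n : ℝ) - α)) = r := by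
        rw [hr', ENNReal.ofReal_rpow_of_pos (by positivity), ← Real.rpow_mul hρ0,
          mul_div_cancel₀ _ (by linarith : (n : ℝ) - α ≠ 0)]
      rw [← h6] at hr
      exact ((ENNReal.rpow_lt_rpow_iff hp).1 hr).le
    have h7 : ENNReal.ofReal (ρ ^ ((n : ℝ) - α)) * ENNReal.ofReal (ρ ^ (α - n)) = 1 := by
      rw [← ENNReal.ofReal_mul (by positivity), ← Real.rpow_add hρ]; simp
    have h8 := rieszKernel_anti hαn (hR.trans hy.1) hy.2
    calc a = a * (ENNReal.ofReal (ρ ^ ((n : ℝ) - α)) * ENNReal.ofReal (ρ ^ (α - n))) := by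
          rw [h7, mul_one]
      _ ≤ a * ((lam * (t / a)) * rieszKernel α y) := by gcongr
      _ = (t / a * a) * (lam * rieszKernel α y) := by ring
      _ ≤ t * (lam * rieszKernel α y) := by gcongr; rw [mul_comm]; exact ENNReal.mul_div_le
      _ = _ := by ring

/-! ### A test function from the divergent integral -/

/-- Layer cake for the measure `w dy` on `|y| > R`: the set `{H ≥ t}` contains `{A t ≤ lam w t}`,
whose mass is of order `(lam t / A t)^p` up to a constant. That constant is harmless because `t`
ranges over a bounded interval. -/
theorem lintegral_slopeInv_eq_top {α : ℝ} (hα0 : 0 < α) (hαn : α < n) {A : ℝ≥0 → ℝ≥0∞}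
    (hA : IsStarShaped A) {δ : ℝ≥0}
    (hint : ∫⁻ t in Set.Ioc (0 : ℝ) δ,
        (ENNReal.ofReal t / A t.toNNReal) ^ (α / ((n : ℝ) - α)) = ∞)
    {R : ℝ} (hR : 0 < R) {lam : ℝ≥0} (hlam : lam ≠ 0) :
    ∫⁻ y in {y : E | R < ‖y‖}, rieszKernel α y * slopeInv A δ (lam * rieszKernel α y) = ∞ := by
  set w : E → ℝ≥0∞ := rieszKernel α with hwdef
  have hw : Measurable w := measurable_rieszKernel α
  set ω := volume (Metric.ball (0 : E) 1)
  have hω0 : ω ≠ 0 := (Metric.measure_ball_pos _ _ one_pos).ne'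
  have hωt : ω ≠ ∞ := measure_ball_lt_top.ne
  have hp : 0 < α / ((n : ℝ) - α) := div_pos hα0 (by linarith)
  set p := α / ((n : ℝ) - α)
  set H : E → ℝ≥0 := fun y => slopeInv A δ (lam * w y) with hH
  have hHm : Measurable H := (slopeInv_mono hA).measurable.comp (hw.const_mul _)
  set ν := (volume.restrict {y : E | R < ‖y‖}).withDensity w with hν
  have hlayer : ∫⁻ y in {y : E | R < ‖y‖}, w y * H y = ∫⁻ t in Set.Ioi (0 : ℝ), ν {y | t ≤ H y} := by
    rw [← lintegral_eq_lintegral_meas_le ν (Eventually.of_forall fun y => NNReal.coe_nonneg (H y))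
      (hHm.coe_nnreal_real.aemeasurable), hν,
      lintegral_withDensity_eq_lintegral_mul _ hw (by fun_prop)]
    simp
  have hpt : ∀ t ∈ Set.Ioc (0 : ℝ) δ,
      ω * (lam * (ENNReal.ofReal t / A t.toNNReal)) ^ p ≤
        ν {y | t ≤ H y} + ω * ENNReal.ofReal (R ^ α) := by
    intro t ht
    have h := mul_rpow_div_le_lintegral_superlevel hα0 hαn hR lam t.toNNReal
      (A t.toNNReal)
    refine h.trans ?_
    gcongr ?_ + _
    have hset : MeasurableSet {y : E | t ≤ H y} :=
      measurableSet_le measurable_const hHm.coe_nnreal_real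
    rw [hν, withDensity_apply _ hset, Measure.restrict_restrict hset]
    refine lintegral_mono_set fun y hy => ⟨?_, hy.1⟩
    have h1 : t.toNNReal ≤ H y := le_slopeInv (by simpa using Real.toNNReal_le_toNNReal ht.2) hy.2
    have h2 : t ≤ (t.toNNReal : ℝ) := Real.le_coe_toNNReal t
    exact h2.trans (by exact_mod_cast h1)
  by_contra hne
  rw [hlayer] at hne
  have hfin : ∫⁻ t in Set.Ioc (0 : ℝ) δ, ω * (lam * (ENNReal.ofReal t / A t.toNNReal)) ^ p < ∞ := by
    refine (setLIntegral_mono' measurableSet_Ioc hpt).trans_lt ?_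
    rw [lintegral_add_right _ measurable_const, setLIntegral_const]
    refine ENNReal.add_lt_top.2 ⟨?_, ?_⟩
    · exact (lintegral_mono_set Set.Ioc_subset_Ioi_self).trans_lt (lt_top_iff_ne_top.2 hne)
    · exact ENNReal.mul_lt_top (ENNReal.mul_lt_top hωt.lt_top ENNReal.ofReal_lt_top) (by simp)
  simp_rw [ENNReal.mul_rpow_of_nonneg _ _ hp.le, ← mul_assoc] at hfin
  have hc0 : ω * (lam : ℝ≥0∞) ^ p ≠ 0 :=
    mul_ne_zero hω0 (by simp [ENNReal.rpow_eq_zero_iff, hlam])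
  have hct : ω * (lam : ℝ≥0∞) ^ p ≠ ∞ :=
    ENNReal.mul_ne_top hωt (ENNReal.rpow_ne_top_of_nonneg hp.le ENNReal.coe_ne_top)
  rw [lintegral_const_mul' _ _ hct, hint, ENNReal.mul_top hc0] at hfin
  exact lt_irrefl _ hfin

/-- A function far away from the origin, with small modular, which is large when paired with the
Riesz kernel. -/
theorem exists_large_pairing {α : ℝ} (hα0 : 0 < α) (hαn : α < n) {A : ℝ≥0 → ℝ≥0∞}
    (hA : IsStarShaped A) {δ : ℝ≥0}
    (hint : ∫⁻ t in Set.Ioc (0 : ℝ) δ,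
        (ENNReal.ofReal t / A t.toNNReal) ^ (α / ((n : ℝ) - α)) = ∞)
    {R : ℝ} (hR : 0 < R) {lam : ℝ≥0} (hlam : lam ≠ 0) :
    ∃ f : E → ℝ≥0, Measurable f ∧ (∀ y, f y ≤ δ) ∧ (∀ y, ‖y‖ ≤ R → f y = 0) ∧
      ∫⁻ y, A (f y) ≤ lam ∧ ∫⁻ y, rieszKernel α y * f y = 2⁻¹ := by
  set w : E → ℝ≥0∞ := rieszKernel α with hwdef
  have hw : Measurable w := measurable_rieszKernel α
  set H : E → ℝ≥0 := fun y => slopeInv A δ (lam * w y) with hH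
  have hHm : Measurable H := (slopeInv_mono hA).measurable.comp (hw.const_mul _)
  set S : ℕ → Set E := fun k => {y : E | R < ‖y‖ ∧ ‖y‖ ≤ k} with hSdef
  have hS : ∀ k, MeasurableSet (S k) := fun k =>
    (measurableSet_lt measurable_const measurable_norm).inter
      (measurableSet_le measurable_norm measurable_const)
  have hSmono : Monotone S := fun i j hij y hy => ⟨hy.1, hy.2.trans (by exact_mod_cast hij)⟩
  have hSU : ⋃ k, S k = {y : E | R < ‖y‖} := by
    ext y
    simp only [S, Set.mem_iUnion, Set.mem_ofPred_eq, exists_and_left, and_iff_left_iff_imp]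
    exact fun _ => exists_nat_ge _
  have hsup : ⨆ k, ∫⁻ y in S k, w y * H y = ∞ := by
    rw [← setLIntegral_iUnion_of_directed _ (directed_of_isDirected_le hSmono), hSU]
    exact lintegral_slopeInv_eq_top hα0 hαn hA hint hR hlam
  -- On a bounded shell away from the origin the pairing is finite, and for a large shell it exceeds
  -- `1`. Normalising therefore multiplies by a factor at most `1`, as star-shapedness requires.
  obtain ⟨k, hk⟩ : ∃ k, 1 < ∫⁻ y in S k, w y * H y := by
    rw [← lt_iSup_iff, hsup]; exact ENNReal.one_lt_top
  set I := ∫⁻ y in S k, w y * H y with hI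
  have hItop : I ≠ ∞ := by
    have : I ≤ ∫⁻ y in S k, ENNReal.ofReal (R ^ (α - n)) * δ :=
      setLIntegral_mono measurable_const fun y hy => by
        gcongr
        · exact rieszKernel_le hαn hR hy.1.le
        · exact slopeInv_le hA _
    refine (this.trans_lt ?_).ne
    rw [setLIntegral_const]
    refine ENNReal.mul_lt_top (ENNReal.mul_lt_top ENNReal.ofReal_lt_top ENNReal.coe_lt_top) ?_
    refine (measure_mono fun y hy => ?_).trans_lt
      (measure_closedBall_lt_top (x := (0 : E)) (r := (k : ℝ)))
    simpa using hy.2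
  obtain ⟨M, hM⟩ : ∃ M : ℝ≥0, (M : ℝ≥0∞) = I := ⟨_, ENNReal.coe_toNNReal hItop⟩
  have hM1 : 1 ≤ M := by
    have : (1 : ℝ≥0∞) < M := hM ▸ hk
    exact_mod_cast this.le
  have hM0 : M ≠ 0 := (zero_lt_one.trans_le hM1).ne'
  have hMinv : M⁻¹ ≤ 1 := inv_le_one_of_one_le₀ hM1
  -- The factor `1/2` makes `apply_half_slopeInv_le` available; `M⁻¹` brings the modular down to
  -- `lam` and the pairing to exactly `1/2`.
  refine ⟨(S k).indicator fun y => M⁻¹ * (H y / 2), ?_, ?_, ?_, ?_, ?_⟩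
  · exact Measurable.indicator (by fun_prop) (hS k)
  · intro y
    refine Set.indicator_le' (f := fun y => M⁻¹ * (H y / 2)) (g := fun _ => δ) (fun y _ => ?_)
      (fun _ _ => zero_le) y
    exact (mul_le_of_le_one_left zero_le hMinv).trans
      ((half_le_self zero_le).trans (slopeInv_le hA _))
  · exact fun y hy => Set.indicator_of_notMem (fun h => absurd h.1 (not_lt.2 hy)) _
  · have : ∀ y, A ((S k).indicator (fun y => M⁻¹ * (H y / 2)) y) ≤
        (S k).indicator (fun y => ((M⁻¹ * lam : ℝ≥0) : ℝ≥0∞) * (w y * H y)) y := by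
      intro y
      by_cases hy : y ∈ S k
      · rw [Set.indicator_of_mem hy, Set.indicator_of_mem hy]
        refine (hA _ _ hMinv).trans ?_
        have := apply_half_slopeInv_le (δ := δ) hA (lam * w y)
        calc ((M⁻¹ : ℝ≥0) : ℝ≥0∞) * A (H y / 2) ≤ ((M⁻¹ : ℝ≥0) : ℝ≥0∞) * (lam * w y * H y) := by
              gcongr
          _ = _ := by push_cast; ring
      · rw [Set.indicator_of_notMem hy, Set.indicator_of_notMem hy, hA.map_zero]
    refine (lintegral_mono this).trans ?_
    rw [lintegral_indicator (hS k), lintegral_const_mul' _ _ ENNReal.coe_ne_top, ← hI, ← hM,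
      ← ENNReal.coe_mul, mul_comm M⁻¹, inv_mul_cancel_right₀ hM0]
  · have : ∀ y, w y * ((S k).indicator (fun y => M⁻¹ * (H y / 2)) y : ℝ≥0) =
        (S k).indicator (fun y => ((M⁻¹ / 2 : ℝ≥0) : ℝ≥0∞) * (w y * H y)) y := by
      intro y
      by_cases hy : y ∈ S k
      · rw [Set.indicator_of_mem hy, Set.indicator_of_mem hy,
          show M⁻¹ * (H y / 2) = M⁻¹ / 2 * H y by ring, ENNReal.coe_mul]
        ring
      · simp [Set.indicator_of_notMem hy]
    simp_rw [this]
    rw [lintegral_indicator (hS k), lintegral_const_mul' _ _ ENNReal.coe_ne_top, ← hI, ← hM,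
      ← ENNReal.coe_mul, div_mul_eq_mul_div, inv_mul_cancel₀ hM0]
    simp

/-- If `∫₀ (t / A t) ^ (α / (n - α)) dt = ∞`, then some bounded function of finite modular has
infinite pairing with the Riesz kernel. -/
theorem exists_infinite_pairing {α : ℝ} (hα0 : 0 < α) (hαn : α < n) {A : ℝ≥0 → ℝ≥0∞}
    (hA : IsStarShaped A) {δ : ℝ≥0}
    (hint : ∫⁻ t in Set.Ioc (0 : ℝ) δ,
        (ENNReal.ofReal t / A t.toNNReal) ^ (α / ((n : ℝ) - α)) = ∞) :
    ∃ f : E → ℝ≥0, Measurable f ∧ (∀ y, f y ≤ δ) ∧ (∀ y, ‖y‖ ≤ 1 → f y = 0) ∧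
      ∫⁻ y, A (f y) < ∞ ∧ ∫⁻ y, rieszKernel α y * f y = ∞ := by
  -- The modulars are summable, while each `f j` contributes pairing `1/2` beyond radius `j + 1`.
  choose f hfm hfδ hf0 hfA hfw using fun j : ℕ =>
    exists_large_pairing hα0 hαn hA hint (R := j + 1) (by positivity) (lam := (1 / 2) ^ j)
      (by positivity)
  have hbdd : ∀ y, BddAbove (Set.range fun j => f j y) := fun y =>
    ⟨δ, by rintro _ ⟨j, rfl⟩; exact hfδ j y⟩
  set g : E → ℝ≥0 := fun y => ⨆ j, f j y with hg
  have hgm : Measurable g := Measurable.iSup hfm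
  have hgδ : ∀ y, g y ≤ δ := fun y => ciSup_le fun j => hfδ j y
  -- Where `g` is nonzero, `g / 2` lies strictly below some `f j`, so its modular is at most the sum
  -- of theirs even if the supremum is not attained.
  refine ⟨fun y => 2⁻¹ * g y, hgm.const_mul _, fun y => ?_, fun y hy => ?_, ?_, ?_⟩
  · exact (mul_le_of_le_one_left zero_le (by norm_num)).trans (hgδ y)
  · have : g y = 0 := by
      refine le_antisymm (ciSup_le fun j => (hf0 j y (hy.trans ?_)).le) zero_le
      simp
    simp [this]
  · have hpt : ∀ y, A (2⁻¹ * g y) ≤ ∑' j, A (f j y) := by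
      intro y
      rcases eq_or_ne (g y) 0 with h0 | h0
      · simp [h0, hA.map_zero]
      · have : 2⁻¹ * g y < g y := by
          rw [inv_mul_eq_div]; exact NNReal.half_lt_self h0
        obtain ⟨j, hj⟩ := exists_lt_of_lt_ciSup this
        exact (hA.monotone hj.le).trans (ENNReal.le_tsum j)
    refine (lintegral_mono hpt).trans_lt ?_
    have hmeas : ∀ j, AEMeasurable (fun y => A (f j y)) volume := fun j =>
      (hA.monotone.measurable.comp (hfm j)).aemeasurable
    rw [lintegral_tsum hmeas]
    refine (ENNReal.tsum_le_tsum hfA).trans_lt ?_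
    refine lt_top_iff_ne_top.2 (ENNReal.tsum_coe_ne_top_iff_summable.2 ?_)
    exact NNReal.summable_geometric (by norm_num [← NNReal.coe_lt_coe])
  · by_contra hne
    have hw : Measurable (rieszKernel (n := n) α) := measurable_rieszKernel α
    -- If the pairing were finite, the `ν`-mass of the sets `|y| > j + 1` would tend to `0`; but
    -- each is at least `1/4`, one half from `f j` and one from halving `g`.
    set ν : Measure E := volume.withDensity fun y => rieszKernel α y * (2⁻¹ * g y : ℝ≥0) with hν
    set T : ℕ → Set E := fun j => {y : E | (j : ℝ) + 1 < ‖y‖} with hT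
    have hTm : ∀ j, MeasurableSet (T j) := fun j =>
      measurableSet_lt measurable_const measurable_norm
    have hlim : Tendsto (fun j => ν (T j)) atTop (nhds (ν (⋂ j, T j))) := by
      refine tendsto_measure_iInter_atTop (fun j => (hTm j).nullMeasurableSet) ?_ ⟨0, ?_⟩
      · intro i j hij y hy
        have : (i : ℝ) ≤ j := by exact_mod_cast hij
        simp only [hT, Set.mem_ofPred_eq] at hy ⊢
        linarith
      · refine ne_top_of_le_ne_top ?_ (measure_mono (Set.subset_univ _))
        rwa [hν, withDensity_apply _ MeasurableSet.univ, Measure.restrict_univ]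
    have hempty : ⋂ j, T j = ∅ := by
      refine Set.eq_empty_of_forall_notMem fun y hy => ?_
      obtain ⟨j, hj⟩ := exists_nat_ge ‖y‖
      have := Set.mem_iInter.1 hy j
      simp only [hT, Set.mem_ofPred_eq] at this
      linarith
    rw [hempty, measure_empty] at hlim
    have hlow : ∀ j, (2⁻¹ * 2⁻¹ : ℝ≥0∞) ≤ ν (T j) := by
      intro j
      rw [hν, withDensity_apply _ (hTm j)]
      calc (2⁻¹ * 2⁻¹ : ℝ≥0∞) = 2⁻¹ * ∫⁻ y, rieszKernel α y * f j y := by rw [hfw j]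
        _ = ∫⁻ y, 2⁻¹ * (rieszKernel α y * f j y) := by
            rw [lintegral_const_mul' _ _ (by simp)]
        _ ≤ ∫⁻ y, (T j).indicator (fun y => rieszKernel α y * (2⁻¹ * g y : ℝ≥0)) y := by
            refine lintegral_mono fun y => ?_
            by_cases hy : y ∈ T j
            · rw [Set.indicator_of_mem hy]
              have h1 : (f j y : ℝ≥0∞) ≤ g y := by exact_mod_cast le_ciSup (hbdd y) j
              calc 2⁻¹ * (rieszKernel α y * f j y) ≤ 2⁻¹ * (rieszKernel α y * g y) := by gcongr
                _ = _ := by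
                  rw [ENNReal.coe_mul, ENNReal.coe_inv two_ne_zero, ENNReal.coe_ofNat]; ring
            · rw [hf0 j y (not_lt.1 hy)]; simp
        _ = _ := lintegral_indicator (hTm j) _
    have := ge_of_tendsto' hlim hlow
    simp at this

/-! ### Growth and left inverses of Young functions -/

/-- A Young function does not vanish identically away from the origin. -/
theorem IsYoung.exists_pos {A : ℝ≥0 → ℝ≥0∞} (hA : IsYoung A) : ∃ s, s ≠ 0 ∧ A s ≠ 0 := by
  obtain ⟨s, t, hst⟩ := hA.nonconstant
  by_contra! h
  have h0 : ∀ s, A s = 0 := fun s => by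
    rcases eq_or_ne s 0 with rfl | hs
    · exact hA.map_zero
    · exact h s hs
  exact hst (by rw [h0, h0])

theorem IsYoung.natCast_mul_le {A : ℝ≥0 → ℝ≥0∞} (hA : IsYoung A) (k : ℕ) (s : ℝ≥0) :
    k * A s ≤ A (k * s) := by
  rcases Nat.eq_zero_or_pos k with rfl | hk
  · simp
  · have hk0 : (k : ℝ≥0) ≠ 0 := by exact_mod_cast hk.ne'
    have h := hA.isStarShaped (k : ℝ≥0)⁻¹ (k * s)
      (inv_le_one_of_one_le₀ (by exact_mod_cast hk))
    rw [inv_mul_cancel_left₀ hk0] at h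
    calc (k : ℝ≥0∞) * A s ≤ k * (((k : ℝ≥0)⁻¹ : ℝ≥0) * A (k * s)) := by gcongr
      _ = A (k * s) := by
        rw [← mul_assoc, ← ENNReal.coe_natCast, ← ENNReal.coe_mul, mul_inv_cancel₀ hk0,
          ENNReal.coe_one, one_mul]

theorem IsYoung.tendsto_natCast_mul {A : ℝ≥0 → ℝ≥0∞} (hA : IsYoung A) {c : ℝ≥0} (hc : 0 < c) :
    Tendsto (fun k : ℕ => A (c * k)) atTop (nhds ∞) := by
  obtain ⟨s, hs, hAs⟩ := hA.exists_pos
  rw [ENNReal.tendsto_nhds_top_iff_nat]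
  intro m
  obtain ⟨l, hl⟩ := ENNReal.exists_nat_mul_gt hAs (ENNReal.natCast_ne_top m)
  obtain ⟨k₀, hk₀⟩ := exists_nat_ge (l * s / c)
  filter_upwards [eventually_ge_atTop k₀] with k hk
  refine (hl.trans_le (hA.natCast_mul_le l s)).trans_le (hA.isStarShaped.monotone ?_)
  have : l * s / c ≤ k := hk₀.trans (by exact_mod_cast hk)
  rw [div_le_iff₀ hc] at this
  rwa [mul_comm c]

theorem IsYoung.leftInv_set_nonempty {A : ℝ≥0 → ℝ≥0∞} (hA : IsYoung A) (t : ℝ≥0) :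
    {τ : ℝ≥0 | (t : ℝ≥0∞) ≤ A τ}.Nonempty := by
  obtain ⟨k, hk⟩ := ((hA.tendsto_natCast_mul one_pos).eventually
    (lt_mem_nhds (ENNReal.coe_lt_top (r := t)))).exists
  exact ⟨_, hk.le⟩

theorem IsYoung.le_leftInv {A : ℝ≥0 → ℝ≥0∞} (hA : IsYoung A) {t τ : ℝ≥0} (h : A τ < t) :
    τ ≤ leftInv A t := by
  refine le_csInf (hA.leftInv_set_nonempty t) fun σ hσ => ?_
  by_contra! hlt
  exact absurd (hσ.trans (hA.isStarShaped.monotone hlt.le)) (not_le.2 h)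

theorem apply_lt_of_lt_leftInv {A : ℝ≥0 → ℝ≥0∞} {t τ : ℝ≥0} (h : τ < leftInv A t) : A τ < t := by
  by_contra! hle
  have h1 : leftInv A t ≤ τ := csInf_le (OrderBot.bddBelow {τ : ℝ≥0 | (t : ℝ≥0∞) ≤ A τ}) hle
  exact absurd h1 (not_le.2 h)

/-! ### Comparison of `φ` and `φ̄` with `φ_∞` -/

theorem isStarShaped_atInfinity {φ : EuclideanSpace ℝ (Fin n) → ℝ≥0 → ℝ≥0∞}
    (hφ : ∀ᵐ x, IsYoung (φ x)) : IsStarShaped (atInfinity φ) := by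
  intro θ t hθ
  unfold atInfinity
  rw [← ENNReal.limsup_const_mul_of_ne_top ENNReal.coe_ne_top]
  refine limsup_le_limsup ?_
  have : ∀ᶠ x in Bornology.cobounded E ⊓ ae volume, IsYoung (φ x) := hφ.filter_mono inf_le_right
  filter_upwards [this] with x hx using hx.isStarShaped θ t hθ

/-- Otherwise the space would be covered by a bounded set, a null set and `{ε ≤ |h|}`, which has
finite measure by Chebyshev's inequality. -/
theorem frequently_enorm_lt (hn : 0 < n) {h : EuclideanSpace ℝ (Fin n) → ℝ} (hh : MemLp h 1 volume)
    {ε : ℝ≥0∞} (hε : ε ≠ 0) :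
    ∃ᶠ x in Bornology.cobounded E ⊓ ae volume, ‖h x‖ₑ < ε := by
  have : Nonempty (Fin n) := ⟨⟨0, hn⟩⟩
  intro hev
  simp only [not_lt] at hev
  obtain ⟨V, hV, N, hN, hVN⟩ := Filter.mem_inf_iff_superset.1 hev
  have hfin : volume {x | ε ≤ ‖h x‖ₑ} < ∞ := by
    by_cases hεt : ε = ∞
    · subst hεt; simp
    refine (meas_ge_le_lintegral_div hh.1.enorm hε hεt).trans_lt ?_
    exact ENNReal.div_lt_top (memLp_one_iff_integrable.1 hh).2.ne hε
  have hVc : volume Vᶜ < ∞ := (Bornology.isBounded_def.2 (by simpa using hV)).measure_lt_top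
  have huniv : volume (Set.univ : Set E) = ∞ := measure_univ_of_isAddLeftInvariant volume
  have hle : volume (Set.univ : Set E) ≤ volume Vᶜ + volume Nᶜ + volume {x | ε ≤ ‖h x‖ₑ} := by
    refine (measure_mono fun x _ => ?_).trans ((measure_union_le _ _).trans
      (add_le_add_left (measure_union_le _ _) _))
    by_cases hxV : x ∈ V
    · by_cases hxN : x ∈ N
      · exact Or.inr (hVN ⟨hxV, hxN⟩)
      · exact Or.inl (Or.inr hxN)
    · exact Or.inl (Or.inl hxV)
  rw [huniv, show volume Nᶜ = 0 from hN, add_zero] at hle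
  exact absurd (hle.trans_lt (ENNReal.add_lt_top.2 ⟨hVc, hfin⟩)) (lt_irrefl _)

/-- There are points far away, avoiding null sets, where `φ` is close to `φ_∞` and `h` is small. -/
theorem exists_point_near_infinity (hn : 0 < n) {φ : EuclideanSpace ℝ (Fin n) → ℝ≥0 → ℝ≥0∞}
    {h : EuclideanSpace ℝ (Fin n) → ℝ} (hh : MemLp h 1 volume) {P : EuclideanSpace ℝ (Fin n) → Prop}
    (hP : ∀ᵐ y, P y) {τ : ℝ≥0} (hτ : atInfinity φ τ ≠ ∞) {ε : ℝ≥0∞} (hε : ε ≠ 0) :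
    ∃ y, P y ∧ φ y τ < atInfinity φ τ + ε ∧ ‖h y‖ₑ < ε := by
  have h1 : ∀ᶠ y in Bornology.cobounded E ⊓ ae volume, φ y τ < atInfinity φ τ + ε :=
    eventually_lt_of_limsup_lt (ENNReal.lt_add_right hτ hε)
  have h2 : ∀ᶠ y in Bornology.cobounded E ⊓ ae volume, P y := hP.filter_mono inf_le_right
  obtain ⟨y, hy, hy1, hy2⟩ := ((frequently_enorm_lt hn hh hε).and_eventually (h1.and h2)).exists
  exact ⟨y, hy2, hy1, hy⟩

/-- Under (A0) and (A2), `φ` is dominated by `φ_∞` up to a dilation and an integrable error. -/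
theorem exists_le_atInfinity_add (hn : 0 < n) {φ : EuclideanSpace ℝ (Fin n) → ℝ≥0 → ℝ≥0∞}
    (hφ : ∀ᵐ x, IsYoung (φ x)) (hA0 : CondA0 φ) (hA2 : CondA2 φ) :
    ∃ κ : ℝ≥0, 0 < κ ∧ ∃ h : EuclideanSpace ℝ (Fin n) → ℝ≥0∞, ∫⁻ x, h x < ∞ ∧
      ∀ᵐ x, ∀ t : ℝ≥0, t ≤ 1 → φ x (κ * t) ≤ atInfinity φ t + h x := by
  obtain ⟨β₀, hβ₀, -, h0⟩ := hA0
  obtain ⟨β, hβ, hβ1, h, hh, -, h2⟩ := hA2 1 one_pos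
  set a : ℝ≥0 → ℝ≥0∞ := atInfinity φ with ha
  have hmono : Monotone a := (isStarShaped_atInfinity hφ).monotone
  refine ⟨min (β / 2) (β₀ / 2), lt_min (half_pos hβ) (half_pos hβ₀), fun x => ‖h x‖ₑ,
    (memLp_one_iff_integrable.1 hh).2, ?_⟩
  -- The bound `β₀ / 2` keeps `φ x (κ t)` below `1`, so that (A2) with `s = 1` applies; `β / 2`
  -- absorbs both the constant of (A2) and the passage from `t` to a rational above `t / 2`.
  set κ := min (β / 2) (β₀ / 2) with hκ
  -- The exceptional null set of `x` in (A2) depends on the comparison point `y`. Picking one `y`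
  -- for each pair `(q, k)` leaves only countably many null sets.
  have hpts : ∀ (q : ℚ) (k : ℕ), ∀ᵐ x, a (Real.toNNReal q) ≠ ∞ →
      ∃ y, IsYoung (φ y) ∧ φ y (Real.toNNReal q) < a (Real.toNNReal q) + (k : ℝ≥0∞)⁻¹ ∧
        ‖h y‖ₑ < (k : ℝ≥0∞)⁻¹ ∧
        ∀ c : ℝ≥0, h y + h x ≤ c → c ≤ 1 → β * leftInv (φ y) c ≤ leftInv (φ x) c := by
    intro q k
    by_cases hq : a (Real.toNNReal q) = ∞
    · exact Eventually.of_forall fun x hx => absurd hq hx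
    obtain ⟨y, ⟨hy1, hy2⟩, hy3, hy4⟩ := exists_point_near_infinity hn hh (hφ.and h2) hq
      (ε := (k : ℝ≥0∞)⁻¹) (by simp)
    filter_upwards [hy2] with x hx _ using ⟨y, hy1, hy3, hy4, hx⟩
  filter_upwards [ae_all_iff.2 fun q => ae_all_iff.2 (hpts q), h0, hφ] with x hx hx0 hxφ t ht
  have hle1 : φ x (κ * t) < 1 := by
    refine apply_lt_of_lt_leftInv (lt_of_lt_of_le ?_ hx0.1)
    calc κ * t ≤ β₀ / 2 * 1 := mul_le_mul' (min_le_right _ _) ht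
      _ < β₀ := by rw [mul_one]; exact NNReal.half_lt_self hβ₀.ne'
  rcases eq_or_ne t 0 with rfl | ht0
  · simp [hxφ.map_zero]
  by_contra! hlt
  -- The level `c` separates the two sides. It exceeds `|h x| + |h y|` and `φ y τ` for a suitable
  -- far point `y`, so (A2) gives `κ t < β τ ≤ leftInv (φ x) c`, hence `φ x (κ t) < c`.
  obtain ⟨c, hc1, hc2⟩ := ENNReal.lt_iff_exists_nnreal_btwn.1 hlt
  have hc_one : c ≤ 1 := by exact_mod_cast (hc2.trans hle1).le
  obtain ⟨q, -, hq1, hq2⟩ := (NNReal.lt_iff_exists_rat_btwn _ _).1 (NNReal.half_lt_self ht0)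
  set τ := Real.toNNReal q
  have hτ : a τ + ‖h x‖ₑ < c := lt_of_le_of_lt (by gcongr; exact hmono hq2.le) hc1
  obtain ⟨k, hk⟩ := ENNReal.exists_inv_nat_lt (tsub_pos_of_lt hτ).ne'
  have hk' : a τ + ‖h x‖ₑ + (k : ℝ≥0∞)⁻¹ < c := by
    rw [add_comm]; exact lt_tsub_iff_right.1 hk
  have haτ : a τ ≠ ∞ := ne_top_of_le_ne_top hτ.ne_top le_self_add
  obtain ⟨y, hy, hy1, hy2, hy3⟩ := hx q k haτ
  have hyc : h y + h x ≤ c := by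
    have h1 : ‖h y‖ₑ + ‖h x‖ₑ ≤ c := by
      refine le_trans ?_ hk'.le
      calc ‖h y‖ₑ + ‖h x‖ₑ ≤ (k : ℝ≥0∞)⁻¹ + ‖h x‖ₑ := by gcongr
        _ ≤ a τ + ‖h x‖ₑ + (k : ℝ≥0∞)⁻¹ := by
          rw [add_assoc, add_comm (‖h x‖ₑ)]; exact le_add_self
    have h3 : ‖h y‖₊ + ‖h x‖₊ ≤ c := by
      simp only [enorm_eq_nnnorm] at h1
      exact_mod_cast h1
    have h4 : ‖h y‖ + ‖h x‖ ≤ c := by exact_mod_cast h3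
    exact (add_le_add (Real.le_norm_self _) (Real.le_norm_self _)).trans h4
  have hτc : φ y τ < c := by
    refine hy1.trans_le (le_trans ?_ hk'.le)
    gcongr
    exact le_self_add
  have h5 : κ * t < leftInv (φ x) c := by
    calc κ * t ≤ β / 2 * t := by gcongr; exact min_le_left _ _
      _ = β * (t / 2) := by ring
      _ < β * τ := by gcongr
      _ ≤ β * leftInv (φ y) c := by gcongr; exact hy.le_leftInv hτc
      _ ≤ _ := hy3 c hyc hc_one
  exact lt_asymm hc2 (apply_lt_of_lt_leftInv h5)

/-- For small arguments, `φ̄` is dominated by a dilation of `φ_∞`. -/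
theorem phiBar_le_atInfinity {φ : EuclideanSpace ℝ (Fin n) → ℝ≥0 → ℝ≥0∞}
    (hφ : ∀ᵐ x, IsYoung (φ x)) {β : ℝ≥0} (hβ : ∀ᵐ x, leftInv (φ x) 1 ≤ 1 / β)
    {t : ℝ≥0} (ht : t ≤ 1 / 2) (x : EuclideanSpace ℝ (Fin n)) :
    phiBar φ x t ≤ atInfinity φ (t / β) := by
  -- Below `1/2` the limsup branch of `φ̄` is in force and the term `2 t - 1` vanishes.
  have ht1 : ¬ 1 ≤ t := not_le.2 (ht.trans_lt (by norm_num [← NNReal.coe_lt_coe]))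
  rw [phiBar, if_neg ht1]
  refine limsup_le_limsup ?_
  have h : ∀ᶠ x in Bornology.cobounded E ⊓ ae volume, IsYoung (φ x) ∧ leftInv (φ x) 1 ≤ 1 / β :=
    (hφ.and hβ).filter_mono inf_le_right
  filter_upwards [h] with x hx
  refine max_le (hx.1.isStarShaped.monotone ?_) ?_
  · calc leftInv (φ x) 1 * t ≤ 1 / β * t := by gcongr; exact hx.2
      _ = t / β := by ring
  · have : 2 * (t : ℝ≥0∞) ≤ 1 := by
      have : 2 * t ≤ 1 := by
        calc 2 * t ≤ 2 * (1 / 2) := by gcongr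
          _ = 1 := by norm_num
      exact_mod_cast this
    rw [tsub_eq_zero_of_le this]
    exact zero_le

/-! ### Infinite potentials and the contradiction -/

/-- Pairing with the kernel centred at the origin controls the Riesz potential at every point. -/
theorem rieszPos_eq_top {α : ℝ} (hαn : α < n) {f : EuclideanSpace ℝ (Fin n) → ℝ≥0}
    (hf0 : ∀ y, ‖y‖ ≤ 1 → f y = 0) (hf : ∫⁻ y, rieszKernel α y * f y = ∞)
    (x : EuclideanSpace ℝ (Fin n)) : rieszPos α (fun y => (f y : ℝ)) x = ∞ := by
  set C : ℝ := (‖x‖ + 1) ^ (α - n) with hC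
  have hCpos : 0 < C := by positivity
  have hpt : ∀ y, y ≠ x → ENNReal.ofReal C * (rieszKernel α y * f y) ≤
      ENNReal.ofReal ((f y : ℝ) / ‖x - y‖ ^ ((n : ℝ) - α)) := by
    intro y hyx
    rcases le_or_gt ‖y‖ 1 with h | h
    · simp [hf0 y h]
    · have hd : 0 < ‖x - y‖ := norm_pos_iff.2 (sub_ne_zero.2 hyx.symm)
      have hle : ‖x - y‖ ≤ (‖x‖ + 1) * ‖y‖ := by
        refine (norm_sub_le x y).trans ?_
        nlinarith [norm_nonneg x]
      have h1 : C * ‖y‖ ^ (α - n) ≤ ‖x - y‖ ^ (α - n) := by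
        rw [hC, ← Real.mul_rpow (by positivity) (by positivity)]
        exact Real.rpow_le_rpow_of_nonpos hd hle (by linarith)
      rw [rieszKernel, ← ENNReal.ofReal_coe_nnreal, ← ENNReal.ofReal_mul (by positivity),
        ← ENNReal.ofReal_mul hCpos.le]
      refine ENNReal.ofReal_le_ofReal ?_
      rw [div_eq_mul_inv, ← Real.rpow_neg hd.le, neg_sub, ← mul_assoc, mul_comm (f y : ℝ)]
      gcongr
  by_cases hn : n = 0
  · subst hn
    have : ∀ y : EuclideanSpace ℝ (Fin 0), f y = 0 := fun y =>
      hf0 y (by simp [Subsingleton.elim y 0])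
    simp [this] at hf
  have : Nonempty (Fin n) := ⟨⟨0, Nat.pos_of_ne_zero hn⟩⟩
  -- At `y = x` real division by zero makes the integrand `0`, so this point is discarded; it is
  -- null because `n ≠ 0`.
  have hae : ∀ᵐ y : E, y ≠ x := by
    simp [ae_iff]
  have h := lintegral_mono_ae (hae.mono hpt)
  rw [lintegral_const_mul' _ _ ENNReal.ofReal_ne_top, hf,
    ENNReal.mul_top (by simpa using hCpos)] at h
  exact top_le_iff.1 h

theorem rieszPotential_eq_top {α : ℝ} {f : EuclideanSpace ℝ (Fin n) → ℝ≥0}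
    {x : EuclideanSpace ℝ (Fin n)} (h : rieszPos α (fun y => (f y : ℝ)) x = ∞) :
    rieszPotential α (fun y => (f y : ℝ)) x = ⊤ := by
  have h0 : rieszPos α (fun y => -(f y : ℝ)) x = 0 := by
    unfold rieszPos
    have : ∀ y, ENNReal.ofReal (-(f y : ℝ) / ‖x - y‖ ^ ((n : ℝ) - α)) = 0 := fun y =>
      ENNReal.ofReal_eq_zero.2 (div_nonpos_of_nonpos_of_nonneg (by simp) (by positivity))
    simp [this]
  simp [rieszPotential, h, h0]

/-- The modular of a generalized Young function cannot stay bounded along dilations. -/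
theorem not_forall_lintegral_le (hn : 0 < n) {ϑ : EuclideanSpace ℝ (Fin n) → ℝ≥0 → ℝ≥0∞}
    (hϑ : IsGeneralizedYoung ϑ) {c : ℝ≥0} (hc : 0 < c) {M : ℝ≥0∞} (hM : M ≠ ∞) :
    ¬ ∀ t : ℝ≥0, ∫⁻ x, ϑ x (c * t) ≤ M := by
  intro h
  have : Nonempty (Fin n) := ⟨⟨0, hn⟩⟩
  -- Fatou along `t = k`: almost every `ϑ x (c k)` tends to `∞`.
  have h1 : ∫⁻ x, liminf (fun k : ℕ => ϑ x (c * k)) atTop = ∞ := by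
    have : (fun x => liminf (fun k : ℕ => ϑ x (c * k)) atTop) =ᵐ[volume] fun _ => ∞ := by
      filter_upwards [hϑ.young] with x hx using (hx.tendsto_natCast_mul hc).liminf_eq
    rw [lintegral_congr_ae this, lintegral_const, measure_univ_of_isAddLeftInvariant]
    simp
  have h2 := lintegral_liminf_le' (u := atTop) fun k : ℕ => hϑ.measurable (c * k)
  rw [h1] at h2
  have h3 : liminf (fun k : ℕ => ∫⁻ x, ϑ x (c * k)) atTop ≤ M :=
    (liminf_le_liminf (Eventually.of_forall fun k : ℕ => h k)).trans_eq (by simp)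
  exact hM (top_le_iff.1 (h2.trans h3))

end MusielakOrlicz

theorem proposition4p3 {n : ℕ} (α : ℝ) (hα0 : 0 < α) (hαn : α < n)
    (φ : EuclideanSpace ℝ (Fin n) → ℝ≥0 → ℝ≥0∞)
    (hφ : MusielakOrlicz.IsGeneralizedYoung φ)
    (hA0 : MusielakOrlicz.CondA0 φ) (hA1 : MusielakOrlicz.CondA1 φ)
    (hA2 : MusielakOrlicz.CondA2 φ)
    (hweak : ∃ (ϑ : EuclideanSpace ℝ (Fin n) → ℝ≥0 → ℝ≥0∞) (c : ℝ≥0),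
      MusielakOrlicz.IsGeneralizedYoung ϑ ∧ 0 < c ∧
        ∀ f : EuclideanSpace ℝ (Fin n) → ℝ, AEMeasurable f volume →
          MusielakOrlicz.luxNorm φ f ≤ 1 → ∀ t : ℝ≥0,
            ∫⁻ x in {x | (t : ℝ≥0∞) < (MusielakOrlicz.rieszPotential α f x).abs}, ϑ x (c * t)
              ≤ MusielakOrlicz.modular (MusielakOrlicz.phiBar φ) f) :
    ∃ δ : ℝ, 0 < δ ∧
      ∫⁻ t in Set.Ioc (0 : ℝ) δ,
        (ENNReal.ofReal t / MusielakOrlicz.atInfinity φ t.toNNReal) ^ (α / ((n : ℝ) - α)) < ∞ := by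
  have hn : 0 < n := by
    have : (0 : ℝ) < n := hα0.trans hαn
    exact_mod_cast this
  by_contra! hdiv
  have hint := top_le_iff.1 (hdiv 1 one_pos)
  have hstar := MusielakOrlicz.isStarShaped_atInfinity hφ.young
  obtain ⟨f, hfm, hf1, hf0, hfA, hfw⟩ := MusielakOrlicz.exists_infinite_pairing hα0 hαn hstar
    (δ := 1) (by simpa using hint)
  obtain ⟨κ, hκ, h, hh, hκh⟩ := MusielakOrlicz.exists_le_atInfinity_add hn hφ.young hA0 hA2
  obtain ⟨β, hβ, -, hβ0⟩ := hA0
  have hM : ∫⁻ x, φ x (κ * f x) < ∞ := by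
    have hle : ∫⁻ x, φ x (κ * f x) ≤
        ∫⁻ x, (MusielakOrlicz.atInfinity φ (f x) + h x) :=
      lintegral_mono_ae (hκh.mono fun x hx => hx _ (hf1 x))
    refine hle.trans_lt ?_
    have hmeas : Measurable fun x => MusielakOrlicz.atInfinity φ (f x) :=
      hstar.monotone.measurable.comp hfm
    rw [lintegral_add_left hmeas]
    exact ENNReal.add_lt_top.2 ⟨hfA, hh⟩
  obtain ⟨M, hM⟩ : ∃ M : ℝ≥0, (M : ℝ≥0∞) = ∫⁻ x, φ x (κ * f x) :=
    ⟨_, ENNReal.coe_toNNReal hM.ne⟩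
  set N : ℝ≥0 := max 1 M
  have hN0 : N ≠ 0 := (zero_lt_one.trans_le (le_max_left 1 M)).ne'
  have hN : N⁻¹ ≤ 1 := inv_le_one_of_one_le₀ (le_max_left _ _)
  -- Here `κ` serves the norm bound, `β` the comparison of `φ̄` with `φ_∞`, and `1/2` the limsup
  -- branch of `φ̄`; dividing by `N` brings the `φ`-modular below `1`.
  set γ : ℝ≥0 := min κ (min β (1 / 2))
  have hγ : γ ≠ 0 := (lt_min hκ (lt_min hβ (by positivity))).ne'
  set F : EuclideanSpace ℝ (Fin n) → ℝ≥0 := fun x => N⁻¹ * (γ * f x)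
  have hFγ : ∀ x, F x ≤ γ * f x := fun x => mul_le_of_le_one_left zero_le hN
  have hFm : Measurable F := (hfm.const_mul _).const_mul _
  have hFw : ∫⁻ y, MusielakOrlicz.rieszKernel α y * F y = ∞ := by
    have : ∀ y, MusielakOrlicz.rieszKernel α y * F y =
        ((N⁻¹ * γ : ℝ≥0) : ℝ≥0∞) * (MusielakOrlicz.rieszKernel α y * f y) := fun y => by
      simp only [F, ENNReal.coe_mul]; ring
    simp_rw [this]
    rw [lintegral_const_mul' _ _ ENNReal.coe_ne_top, hfw, ENNReal.mul_top]
    exact ENNReal.coe_ne_zero.2 (mul_ne_zero (inv_ne_zero hN0) hγ)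
  have hlux : MusielakOrlicz.luxNorm φ (fun x => (F x : ℝ)) ≤ 1 := by
    have hle : ∫⁻ x, φ x (‖(F x : ℝ)‖₊ / 1) ≤ 1 := by
      calc ∫⁻ x, φ x (‖(F x : ℝ)‖₊ / 1) ≤ ∫⁻ x, ((N⁻¹ : ℝ≥0) : ℝ≥0∞) * φ x (κ * f x) := by
            refine lintegral_mono_ae (hφ.young.mono fun x hx => ?_)
            refine le_trans ?_ (hx.isStarShaped _ _ hN)
            refine hx.isStarShaped.monotone ?_
            simp only [NNReal.nnnorm_eq, div_one, F]
            gcongr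
            exact min_le_left _ _
        _ = ((N⁻¹ * M : ℝ≥0) : ℝ≥0∞) := by
            rw [lintegral_const_mul' _ _ ENNReal.coe_ne_top, ← hM, ENNReal.coe_mul]
        _ ≤ 1 := by
            have : N⁻¹ * M ≤ 1 := by
              rw [← inv_mul_cancel₀ hN0]; gcongr; exact le_max_right _ _
            exact_mod_cast this
    exact (iInf_le_of_le 1 (iInf₂_le_of_le one_pos hle le_rfl)).trans_eq ENNReal.coe_one
  have hmod : MusielakOrlicz.modular (MusielakOrlicz.phiBar φ) (fun x => (F x : ℝ)) < ∞ := by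
    refine (lintegral_mono fun x => ?_).trans_lt hfA
    rw [NNReal.nnnorm_eq]
    have hF2 : F x ≤ 1 / 2 := (hFγ x).trans (by
      calc γ * f x ≤ 1 / 2 * 1 := by
            gcongr
            · exact (min_le_right _ _).trans (min_le_right _ _)
            · exact hf1 x
        _ = 1 / 2 := mul_one _)
    refine (MusielakOrlicz.phiBar_le_atInfinity hφ.young (hβ0.mono fun _ h => h.2) hF2 x).trans
      (hstar.monotone ?_)
    rw [div_le_iff₀ hβ, mul_comm (f x)]
    refine (hFγ x).trans ?_
    gcongr
    exact (min_le_right _ _).trans (min_le_left _ _)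
  obtain ⟨ϑ, c, hϑ, hc, hineq⟩ := hweak
  refine MusielakOrlicz.not_forall_lintegral_le hn hϑ hc hmod.ne fun t => ?_
  have hset : {x | (t : ℝ≥0∞) < (MusielakOrlicz.rieszPotential α (fun x => (F x : ℝ)) x).abs} =
      Set.univ := by
    refine Set.eq_univ_of_forall fun x => ?_
    have := MusielakOrlicz.rieszPotential_eq_top (MusielakOrlicz.rieszPos_eq_top hαn
      (fun y hy => by simp [F, hf0 y hy]) hFw x)
    simp [this]
  have := hineq (fun x => (F x : ℝ)) hFm.coe_nnreal_real.aemeasurable hlux t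
  rwa [hset, Measure.restrict_univ] at this
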